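/- **Proposition.** Pitch classes are the elements of $\mathbb R/12\mathbb Z$ (semitones modulo the octave). A *mode* is a heptatonic scale obtained by playing, cyclically from one of its seven degrees, a transposition of the major scale $(0,2,4,5,7,9,11)$, the melodic minor scale $(0,2,3,5,7,9,11)$ or the harmonic minor scale $(0,2,3,5,7,8,11)$. Its *base-chord* is the sequence of its 1st, 3rd, 5th and 7th notes (a seventh chord in root position), and its *tension-triad* consists of its 2nd, 4th and 6th notes. The seventh chords with root $r$ have the following notes, in semitones above $r$: $^{\circ7}=(0,3,6,9)$, $maj7^{\sharp5}=(0,4,8,11)$, $-maj7=(0,3,7,11)$, $maj7=(0,4,7,11)$, $7=(0,4,7,10)$, $-7=(0,3,7,10)$, $-7^{\flat5}=(0,3,6,10)$. For a base-chord $B$, let $\mathscr G(B)$ be the graph whose vertices are the notes of $B$ and of the tension-triads of all modes with base-chord $B$, and in which every note that occurs as the $i$-th degree of a mode with base-chord $B$ is joined by an edge to every note that occurs as the $(i+1)$-st degree of such a mode, for $i=1,\dots,6$. A *realization* of a finite graph in $\mathbb R^N$ represents the vertices by distinct points and the edges by the straight segments joining the corresponding points, in such a way that two different edges meet in a common end-point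 or not at all, and that no vertex lies on an edge except at one of its ends. Let $\tau(B)$ be the number of free generators of the fundamental group of a realization of $\mathscr G(B)$. Then, for every root $r$ and each of the seven types, $\mathscr G(B)$ has a realization in the plane $\mathbb R^2$, and for every realization of $\mathscr G(B)$, in any $\mathbb R^N$, and every base point in it, the fundamental group and $\tau(B)$ are as follows: | base-chord $B$ | $\pi_1(\mathscr G(B))$ | $\tau(B)$ | |---|---|---| | $^{\circ7}$ | trivial | $0$ | | $maj7^{\sharp5}$ | $\mathbb Z$ | $1$ | | $-maj7$ | $\mathbb Z$ | $1$ | | $maj7$ | free group on $2$ generators | $2$ | | $7$ | free group on $3$ generators | $3$ | | $-7$ | free group on $3$ generators | $3$ | | $-7^{\flat5}$ | free group on $3$ generators | $3$ | -/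

import Mathlib

noncomputable section

/-! ### Pitch classes, modes and base-chords -/

/-- Pitch classes, measured in semitones modulo the octave. -/
abbrev PitchClass : Type := AddCircle (12 : ℝ)

/-- The scales from which the modes are deduced. -/
inductive ParentScale
  | major
  | melodicMinor
  | harmonicMinor

/-- The seven degrees of a parent scale, in semitones above its tonic. -/
def ParentScale.semitones : ParentScale → Fin 7 → ℤ
  | .major => ![0, 2, 4, 5, 7, 9, 11]
  | .melodicMinor => ![0, 2, 3, 5, 7, 9, 11]
  | .harmonicMinor => ![0, 2, 3, 5, 7, 8, 11]

/-- A (standard) mode: the parent scale of type `scale` on the tonic `tonic`, played from its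
degree `start` (degrees are numbered from `0`). -/
structure MusicalMode where
  scale : ParentScale
  tonic : PitchClass
  start : Fin 7

/-- The `i`-th note of the modal scale; the degrees `I, …, VII` are `i = 0, …, 6`.
The addition `m.start + i` is cyclic, in `Fin 7`. -/
def MusicalMode.note (m : MusicalMode) (i : Fin 7) : PitchClass :=
  m.tonic + ((m.scale.semitones (m.start + i) : ℝ) : PitchClass)

/-- The base-chord of a mode in root position: first, third, fifth and seventh degree. -/
def MusicalMode.baseChord (m : MusicalMode) : Fin 4 → PitchClass :=
  ![m.note 0, m.note 2, m.note 4, m.note 6]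

/-- The tension-triad of a mode: second, fourth and sixth degree. -/
def MusicalMode.tensionTriad (m : MusicalMode) : Fin 3 → PitchClass :=
  ![m.note 1, m.note 3, m.note 5]

/-- The seven types of seventh chords. -/
inductive ChordType
  | dim7
  | maj7sharp5
  | minMaj7
  | maj7
  | dom7
  | min7
  | min7flat5

/-- Root, third, fifth and seventh of a seventh chord, in semitones above the root. -/
def ChordType.semitones : ChordType → Fin 4 → ℤ
  | .dim7 => ![0, 3, 6, 9]
  | .maj7sharp5 => ![0, 4, 8, 11]
  | .minMaj7 => ![0, 3, 7, 11]
  | .maj7 => ![0, 4, 7, 11]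
  | .dom7 => ![0, 4, 7, 10]
  | .min7 => ![0, 3, 7, 10]
  | .min7flat5 => ![0, 3, 6, 10]

/-- The seventh chord of type `c` with root `r`, in root position. -/
def seventhChord (c : ChordType) (r : PitchClass) : Fin 4 → PitchClass :=
  fun j => r + ((c.semitones j : ℝ) : PitchClass)

/-! ### The base-chord graph -/

/-- The notes of the chord `B` and of every compatible tension-triad, i.e. of the tension-triad of
every mode whose base-chord is `B`. -/
def baseChordNotes (B : Fin 4 → PitchClass) : Set PitchClass :=
  Set.range B ∪ ⋃ m ∈ {m : MusicalMode | m.baseChord = B}, Set.range m.tensionTriad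

/-- `v` occurs as the `i`-th degree of some mode with base-chord `B`. -/
def IsDegree (B : Fin 4 → PitchClass) (i : Fin 7) (v : PitchClass) : Prop :=
  ∃ m : MusicalMode, m.baseChord = B ∧ m.note i = v

/-- The oriented base-chord graph: every note occurring as some degree is joined to every note
occurring as the next degree, from the root up to the seventh (there is no edge from the seventh
back to the root). -/
def baseChordDigraph (B : Fin 4 → PitchClass) : Digraph (baseChordNotes B) where
  Adj v w := ∃ i : Fin 6, IsDegree B i.castSucc v ∧ IsDegree B i.succ w

/-- The base-chord graph without its orientation. -/
def baseChordGraph (B : Fin 4 → PitchClass) : SimpleGraph (baseChordNotes B) :=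
  (baseChordDigraph B).toSimpleGraphInclusive

theorem baseChordNotes_finite (B : Fin 4 → PitchClass) : (baseChordNotes B).Finite := by
  refine (Set.finite_range B).union ?_
  have hP : Finite ParentScale := by
    refine Finite.of_injective
      (fun s : ParentScale => match s with
        | .major => (0 : Fin 3) | .melodicMinor => 1 | .harmonicMinor => 2) ?_
    intro a b h
    cases a <;> cases b <;> simp_all
  refine (Set.finite_range (fun q : ParentScale × Fin 7 × Fin 3 =>
    (MusicalMode.mk q.1 (B 0 - ((q.1.semitones q.2.1 : ℝ) : PitchClass)) q.2.1).tensionTriad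
      q.2.2)).subset ?_
  intro v hv
  simp only [Set.mem_iUnion, Set.mem_ofPred_eq, Set.mem_range] at hv
  obtain ⟨⟨s, t, d⟩, rfl, j, rfl⟩ := hv
  exact ⟨(s, d, j), by simp [MusicalMode.baseChord, MusicalMode.note]⟩

instance (B : Fin 4 → PitchClass) : Finite (baseChordNotes B) :=
  (baseChordNotes_finite B).to_subtype

/-! ### Realizations of finite graphs -/

/-- A realization in `ℝ^N` of a finite abstract graph: one point for each vertex and the segments
joining the pairs of points that correspond to edges. -/
structure GraphRealization {V : Type*} [Finite V] (G : SimpleGraph V) (N : ℕ) where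
  /-- the point of `ℝ^N` representing a vertex -/
  point : V → EuclideanSpace ℝ (Fin N)
  point_injective : Function.Injective point
  /-- two different edges meet in a common end-point or not at all -/
  edge_inter : ∀ v w v' w' : V, G.Adj v w → G.Adj v' w' → s(v, w) ≠ s(v', w') →
    ∀ x ∈ segment ℝ (point v) (point w) ∩ segment ℝ (point v') (point w'),
      ∃ u : V, u ∈ s(v, w) ∧ u ∈ s(v', w') ∧ x = point u
  /-- no vertex lies on an edge except at one of its ends -/
  vertex_edge : ∀ u v w : V, G.Adj v w → point u ∈ segment ℝ (point v) (point w) → u ∈ s(v, w)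

/-- The points of the realization: all its vertices and edges. As a subset of `ℝ^N` it carries the
subspace topology. -/
def GraphRealization.carrier {V : Type*} [Finite V] {G : SimpleGraph V} {N : ℕ}
    (P : GraphRealization G N) : Set (EuclideanSpace ℝ (Fin N)) :=
  Set.range P.point ∪
    ⋃ e ∈ {e : V × V | G.Adj e.1 e.2}, segment ℝ (P.point e.1) (P.point e.2)

/-! ### The number of free generators -/

/-- The number of free generators of a finitely generated free group. -/
def numFreeGenerators (G : Type*) [Group G] : ℕ :=
  sInf {n : ℕ | Nonempty (FreeGroupBasis (Fin n) G)}

/-- All free bases have the same number of elements, so the infimum in the definition is taken over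
a one-element set. -/
theorem numFreeGenerators_eq {G : Type*} [Group G] {n : ℕ} (b : FreeGroupBasis (Fin n) G) :
    numFreeGenerators G = n := by
  have h : {k : ℕ | Nonempty (FreeGroupBasis (Fin k) G)} = {n} := by
    ext k
    simp only [Set.mem_ofPred_eq, Set.mem_singleton_iff]
    constructor
    · rintro ⟨b'⟩
      exact Fin.equiv_iff_eq.mp ⟨Equiv.ofFreeGroupEquiv (b'.repr.symm.trans b.repr)⟩
    · rintro rfl
      exact ⟨b⟩
  rw [numFreeGenerators, h, csInf_singleton]

/-- The topological complexity measure `τ`: the number of free generators of the fundamental group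
of the realized graph. -/
def GraphRealization.complexity {V : Type*} [Finite V] {G : SimpleGraph V} {N : ℕ}
    (P : GraphRealization G N) (x : P.carrier) : ℕ :=
  numFreeGenerators (FundamentalGroup P.carrier x)

end

/-! A degree that belongs to the base-chord is the same note in all modes over it, while each of the
three tension degrees takes one or two values. As consecutive degrees are joined completely, the
graph is a chain of three links, each a path of two edges or a square; distinct degrees give
distinct notes modulo 12. So it is a spanning tree with one chord per square, and the fundamental
group is free on these chords. Transposition removes the root, and the shape of each graph becomes a
finite check (`TreeWithChords.Models`).

The topological core is that a realized graph with a rooted spanning tree and `n` chords has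
fundamental group free of rank `n`. Open stars of the vertices form a cover by simply connected
sets, with connected double and empty triple intersections (`GraphRealization.starCover`). Each
chord gives a loop through the tree. Cutting a path into pieces that lie in single stars shows that
these loops generate (`StarCover.eq_top_of_edge_mem`). They are independent because the trivial
bundles with discrete fibre `FreeGroup (Fin n)`, glued along the `i`-th chord by the `i`-th
generator and along the tree by `1`, form a covering in which the loop of a word acts as left
multiplication by that word (`TreeWithChords.hasLabel_lift_chordLoop`).

For planarity the vertices are placed on a parabola in an order in which no two edges interlace. -/

/-! ### Coverings glued over a star cover -/

noncomputable section

open CategoryTheory unitInterval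

/-- A cover of `X` by simply connected open sets, whose pairwise intersections are path connected
or empty and whose triple intersections are empty. -/
structure StarCover (X V : Type*) [TopologicalSpace X] where
  star : V → Set X
  isOpen_star : ∀ v, IsOpen (star v)
  index : X → V
  mem_star_index : ∀ x, x ∈ star (index x)
  center : V → X
  center_mem : ∀ v, center v ∈ star v
  isSimplyConnected_star : ∀ v, IsSimplyConnected (star v)
  joinedIn_inter : ∀ v u, v ≠ u → ∀ x ∈ star v ∩ star u, ∀ y ∈ star v ∩ star u,
    JoinedIn (star v ∩ star u) x y
  triple_inter : ∀ v u t x, x ∈ star v → x ∈ star u → x ∈ star t → v = u ∨ u = t ∨ v = t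

namespace StarCover

variable {X V H : Type*} [TopologicalSpace X] (C : StarCover X V) [Group H] [TopologicalSpace H]
  [DiscreteTopology H]

/-- A labelling of oriented edges by elements of `H` glues trivial `H`-bundles over the stars. -/
def bundleCore (w : V → V → H) (hw : ∀ v, w v v = 1) (hw' : ∀ v u, w v u * w u v = 1) :
    FiberBundleCore V X H where
  baseSet := C.star
  isOpen_baseSet := C.isOpen_star
  indexAt := C.index
  mem_baseSet_at := C.mem_star_index
  coordChange v u _ h := w v u * h
  coordChange_self v _ _ h := by simp [hw]
  continuousOn_coordChange v u :=
    ((continuous_of_discreteTopology (f := fun h : H => w v u * h)).comp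
      continuous_snd).continuousOn
  coordChange_comp v u t x hx h := by
    -- Triple intersections being empty, the cocycle condition is needed only when two of the three
    -- indices agree.
    rcases C.triple_inter v u t x hx.1.1 hx.1.2 hx.2 with rfl | rfl | rfl
    · simp [hw]
    · simp [hw]
    · simp [← mul_assoc, hw, hw']

section Monodromy

variable (w : V → V → H) (hw : ∀ v, w v v = 1) (hw' : ∀ v u, w v u * w u v = 1)

theorem isCoveringMap_proj : IsCoveringMap (C.bundleCore w hw hw').proj :=
  FiberBundle.isCoveringMap (E := (C.bundleCore w hw hw').Fiber)

/-- The coordinate over the star of `v`. -/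
def coord (v : V) (e : (C.bundleCore w hw hw').TotalSpace) : H :=
  ((C.bundleCore w hw hw').localTriv v e).2

theorem coord_eq (v : V) (e : (C.bundleCore w hw hw').TotalSpace) :
    C.coord w hw hw' v e = w (C.index e.1) v * (show H from e.2) := rfl

theorem coord_change {v u : V} (e : (C.bundleCore w hw hw').TotalSpace) (hv : e.1 ∈ C.star v)
    (hu : e.1 ∈ C.star u) : C.coord w hw hw' u e = w v u * C.coord w hw hw' v e := by
  rw [coord_eq, coord_eq]
  exact ((C.bundleCore w hw hw').coordChange_comp (C.index e.1) v u e.1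
    ⟨⟨C.mem_star_index _, hv⟩, hu⟩ e.2).symm

theorem coord_surjective (v : V) (x : X) (h : H) :
    ∃ e : (C.bundleCore w hw hw').proj ⁻¹' {x}, C.coord w hw hw' v e = h :=
  ⟨⟨⟨x, (w (C.index x) v)⁻¹ * h⟩, rfl⟩, mul_inv_cancel_left _ _⟩

theorem continuousOn_coord (v : V) :
    ContinuousOn (C.coord w hw hw' v) ((C.bundleCore w hw hw').proj ⁻¹' C.star v) := by
  have := ((C.bundleCore w hw hw').localTriv v).continuousOn_toFun
  refine (continuous_snd.comp_continuousOn this).mono ?_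
  intro e he
  exact ((C.bundleCore w hw hw').mem_localTriv_source v e).2 he

/-- Along the lift the coordinate is a continuous map from the interval to a discrete space, hence
constant. -/
theorem coord_monodromy_of_forall_mem {v : V} {x y : X} (γ : Path x y) (hγ : ∀ t, γ t ∈ C.star v)
    (e : (C.bundleCore w hw hw').proj ⁻¹' {x}) :
    C.coord w hw hw' v ((C.isCoveringMap_proj w hw hw').monodromy (.mk γ) e).1 =
      C.coord w hw hw' v e.1 := by
  set cov := C.isCoveringMap_proj w hw hw'
  have h0 : γ 0 = (C.bundleCore w hw hw').proj e.1 := γ.source.trans e.2.symm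
  have hl : ∀ t, (C.bundleCore w hw hw').proj (cov.liftPath γ e.1 h0 t) = γ t :=
    congr_fun (cov.liftPath_lifts γ e.1 h0)
  have hc : Continuous fun t => C.coord w hw hw' v (cov.liftPath γ e.1 h0 t) :=
    (C.continuousOn_coord w hw hw' v).comp_continuous (cov.liftPath γ e.1 h0).continuous
      fun t => by simpa only [Set.mem_preimage, hl] using hγ t
  have := PreconnectedSpace.constant (inferInstance : PreconnectedSpace I) hc (x := 1) (y := 0)
  rw [cov.liftPath_zero] at this
  exact this

end Monodromy

end StarCover
end

/-! ### Homotopy classes of paths in a star cover -/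

noncomputable section

open CategoryTheory unitInterval

namespace StarCover

variable {X V H : Type*} [TopologicalSpace X] (C : StarCover X V) [Group H] [TopologicalSpace H]
  [DiscreteTopology H]

theorem mk_eq_of_forall_mem {v : V} {x y : X} (γ γ' : Path x y) (hγ : ∀ t, γ t ∈ C.star v)
    (hγ' : ∀ t, γ' t ∈ C.star v) :
    Path.Homotopic.Quotient.mk γ = Path.Homotopic.Quotient.mk γ' := by
  have := (C.isSimplyConnected_star v).simplyConnectedSpace
  have hx : x ∈ C.star v := by simpa using hγ 0
  have hy : y ∈ C.star v := by simpa using hγ 1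
  let δ : Path (⟨x, hx⟩ : C.star v) ⟨y, hy⟩ :=
    ⟨⟨fun t => ⟨γ t, hγ t⟩, by fun_prop⟩, Subtype.ext γ.source, Subtype.ext γ.target⟩
  let δ' : Path (⟨x, hx⟩ : C.star v) ⟨y, hy⟩ :=
    ⟨⟨fun t => ⟨γ' t, hγ' t⟩, by fun_prop⟩, Subtype.ext γ'.source, Subtype.ext γ'.target⟩
  exact Path.Homotopic.Quotient.eq.2
    ((SimplyConnectedSpace.paths_homotopic δ δ').map ⟨Subtype.val, continuous_subtype_val⟩)

theorem joinedIn_star (v : V) {x : X} (hx : x ∈ C.star v) : JoinedIn (C.star v) (C.center v) x :=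
  (C.isSimplyConnected_star v).isPathConnected.joinedIn _ (C.center_mem v) _ hx

/-- The homotopy class of a path in the star of `v` from its center to `x`. -/
def ray (v : V) (x : X) (hx : x ∈ C.star v) :
    FundamentalGroupoid.mk (C.center v) ⟶ FundamentalGroupoid.mk x :=
  Path.Homotopic.Quotient.mk (C.joinedIn_star v hx).somePath

theorem ray_comp_mk {v : V} {x y : X} (hx : x ∈ C.star v) (hy : y ∈ C.star v) (γ : Path x y)
    (hγ : ∀ t, γ t ∈ C.star v) :
    C.ray v x hx ≫ (show FundamentalGroupoid.mk x ⟶ FundamentalGroupoid.mk y from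
      Path.Homotopic.Quotient.mk γ) = C.ray v y hy := by
  rw [FundamentalGroupoid.comp_eq]
  refine (Path.Homotopic.Quotient.mk_trans _ _).symm.trans (C.mk_eq_of_forall_mem (v := v) _ _ ?_
    (JoinedIn.somePath_mem _))
  intro t
  have : Set.range ((C.joinedIn_star v hx).somePath.trans γ) ⊆ C.star v := by
    rw [Path.trans_range, Set.union_subset_iff, Set.range_subset_iff, Set.range_subset_iff]
    exact ⟨JoinedIn.somePath_mem _, hγ⟩
  exact this (Set.mem_range_self t)

theorem ray_center (v : V) : C.ray v (C.center v) (C.center_mem v) = 𝟙 _ :=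
  C.mk_eq_of_forall_mem (v := v) _ (Path.refl _) (JoinedIn.somePath_mem _)
    fun _ => C.center_mem v

/-- The homotopy class of a path between the centers of two stars, through a common point. -/
def edge (v u : V) (x : X) (hv : x ∈ C.star v) (hu : x ∈ C.star u) :
    FundamentalGroupoid.mk (C.center v) ⟶ FundamentalGroupoid.mk (C.center u) :=
  C.ray v x hv ≫ Groupoid.inv (C.ray u x hu)

theorem edge_self (v : V) (x : X) (hv : x ∈ C.star v) : C.edge v v x hv hv = 𝟙 _ :=
  Groupoid.comp_inv _

theorem edge_inv (v u : V) (x : X) (hv : x ∈ C.star v) (hu : x ∈ C.star u) :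
    Groupoid.inv (C.edge v u x hv hu) = C.edge u v x hu hv := by
  simp [edge, Groupoid.inv_eq_inv]

/-- A path from `x` to `y` inside the intersection extends both rays and cancels. This makes the
class of an edge independent of the chosen crossing point. -/
theorem edge_eq (v u : V) (hvu : v ≠ u) (x y : X) (hv : x ∈ C.star v) (hu : x ∈ C.star u)
    (hv' : y ∈ C.star v) (hu' : y ∈ C.star u) : C.edge v u x hv hu = C.edge v u y hv' hu' := by
  have h := C.joinedIn_inter v u hvu x ⟨hv, hu⟩ y ⟨hv', hu'⟩
  rw [edge, edge, ← C.ray_comp_mk hv hv' h.somePath fun t => (h.somePath_mem t).1,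
    ← C.ray_comp_mk hu hu' h.somePath fun t => (h.somePath_mem t).2]
  simp [Groupoid.inv_eq_inv]

/-! ### Generation of the fundamental group by edge loops -/

section Generation

variable {C} {r : V} (τ : ∀ v, FundamentalGroupoid.mk (C.center r) ⟶ .mk (C.center v))
  (S : Subgroup (FundamentalGroup X (C.center r)))

/-- A homotopy class of paths, closed up by the paths `τ` and rays, gives elements of `S`. -/
def ClosesIn {x y : X} (q : FundamentalGroupoid.mk x ⟶ FundamentalGroupoid.mk y) : Prop :=
  ∀ (v u : V) (hx : x ∈ C.star v) (hy : y ∈ C.star u),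
    (τ v ≫ C.ray v x hx ≫ q ≫ Groupoid.inv (C.ray u y hy) ≫ Groupoid.inv (τ u) :
      FundamentalGroup X (C.center r)) ∈ S

variable {τ S}
  (hS : ∀ v u x hv hu, (τ v ≫ C.edge v u x hv hu ≫ Groupoid.inv (τ u) :
    FundamentalGroup X (C.center r)) ∈ S)
include hS

theorem closesIn_id (x : X) : ClosesIn τ S (𝟙 (FundamentalGroupoid.mk x)) := by
  intro v u hx hy
  have := hS v u x hx hy
  simpa only [edge, Category.id_comp, Category.assoc] using this

theorem ClosesIn.comp_mk {x y z : X} {q : FundamentalGroupoid.mk x ⟶ FundamentalGroupoid.mk y}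
    (hq : ClosesIn τ S q) {t : V} (γ : Path y z) (hγ : ∀ s, γ s ∈ C.star t) :
    ClosesIn τ S (q ≫ (show FundamentalGroupoid.mk y ⟶ FundamentalGroupoid.mk z from
      Path.Homotopic.Quotient.mk γ)) := by
  intro v u hx hz
  have hy : y ∈ C.star t := by simpa using hγ 0
  have hz' : z ∈ C.star t := by simpa using hγ 1
  -- Multiplication in `End` composes from right to left. The path is closed up in the star of `t`
  -- at `y`, and the edge loop at `z` changes `t` to `u`.
  have h := S.mul_mem (hS t u z hz' hz) (hq v t hx hy)
  rw [End.mul_def, edge, ← C.ray_comp_mk hy hz' γ hγ] at h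
  simpa only [Groupoid.inv_eq_inv, Category.assoc, IsIso.inv_hom_id_assoc] using h

/-- By compactness the interval splits into finitely many pieces, each mapped into one star; the
pieces are added one at a time. -/
theorem closesIn_mk {x y : X} (γ : Path x y) :
    ClosesIn τ S (show FundamentalGroupoid.mk x ⟶ FundamentalGroupoid.mk y from
      Path.Homotopic.Quotient.mk γ) := by
  obtain ⟨t, t0, tmono, ⟨n, hn⟩, ht⟩ := exists_monotone_Icc_subset_open_cover_unitInterval
    (c := fun v => γ ⁻¹' C.star v) (fun v => (C.isOpen_star v).preimage γ.continuous)
    fun s _ => Set.mem_iUnion.2 ⟨_, C.mem_star_index (γ s)⟩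
  have key : ∀ m, ClosesIn τ S (show FundamentalGroupoid.mk (γ 0) ⟶ FundamentalGroupoid.mk (γ (t m))
      from Path.Homotopic.Quotient.mk (γ.subpath 0 (t m))) := by
    intro m
    induction m with
    | zero =>
      rw [t0, Path.subpath_self]
      exact closesIn_id hS _
    | succ m ih =>
      obtain ⟨v, hv⟩ := ht m
      have h := ih.comp_mk hS (t := v) (γ.subpath (t m) (t (m + 1))) fun s => by
        have : γ.subpath (t m) (t (m + 1)) s ∈ Set.range (γ.subpath (t m) (t (m + 1))) :=
          Set.mem_range_self s
        rw [Path.range_subpath_of_le _ _ _ (tmono m.le_succ)] at this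
        obtain ⟨s', hs', h⟩ := this
        rw [← h]
        exact hv hs'
      rw [FundamentalGroupoid.comp_eq] at h
      erw [← Path.Homotopic.Quotient.mk_trans] at h
      rwa [Path.Homotopic.Quotient.eq.2 ⟨Path.Homotopy.subpathTransSubpath γ 0 (t m) (t (m + 1))⟩]
        at h
  have h := key n
  rw [hn n le_rfl, Path.subpath_zero_one] at h
  -- The end-points `γ 0`, `γ 1` equal `x`, `y` only propositionally.
  have cast_aux : ∀ {x' y' : X} (hx : x' = x) (hy : y' = y),
      ClosesIn τ S (show FundamentalGroupoid.mk x' ⟶ FundamentalGroupoid.mk y' from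
        Path.Homotopic.Quotient.mk (γ.cast hx hy)) →
      ClosesIn τ S (show FundamentalGroupoid.mk x ⟶ FundamentalGroupoid.mk y from
        Path.Homotopic.Quotient.mk γ) := by
    rintro x' y' rfl rfl h
    exact h
  exact cast_aux _ _ h

/-- For a loop at the center of the root star, both rays and `τ r` are trivial, so closing up
returns the loop itself. -/
theorem eq_top_of_edge_mem (hτ : τ r = 𝟙 _) : S = ⊤ := by
  rw [eq_top_iff]
  rintro ⟨γ⟩ -
  have h := closesIn_mk hS γ r r (C.center_mem r) (C.center_mem r)
  simp only [ray_center, hτ, Groupoid.inv_eq_inv, IsIso.inv_id, Category.id_comp,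
    Category.comp_id] at h
  exact h

end Generation

/-! ### Monodromy in coordinates -/

section Labels

variable (w : V → V → H) (hw : ∀ v, w v v = 1) (hw' : ∀ v u, w v u * w u v = 1)

/-- Transport along `q` is left multiplication by `g` in the coordinates over the stars of `v`
and `u`. -/
def HasLabel {x y : X} (q : FundamentalGroupoid.mk x ⟶ FundamentalGroupoid.mk y) (v u : V)
    (g : H) : Prop :=
  ∀ e, C.coord w hw hw' u ((C.isCoveringMap_proj w hw hw').monodromy q e).1 =
    g * C.coord w hw hw' v e.1

variable {w hw hw'}

theorem hasLabel_id (x : X) (v : V) :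
    C.HasLabel w hw hw' (𝟙 (FundamentalGroupoid.mk x)) v v 1 := by
  intro e
  rw [one_mul]
  exact congr_arg (fun e : (C.bundleCore w hw hw').proj ⁻¹' {x} => C.coord w hw hw' v e.1)
    (congr_fun ((C.isCoveringMap_proj w hw hw').monodromy_refl (x := x)) e)

variable {C}

theorem HasLabel.comp {x y z : X} {q : FundamentalGroupoid.mk x ⟶ FundamentalGroupoid.mk y}
    {q' : FundamentalGroupoid.mk y ⟶ FundamentalGroupoid.mk z} {v u t : V} {g g' : H}
    (h : C.HasLabel w hw hw' q v u g) (h' : C.HasLabel w hw hw' q' u t g') :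
    C.HasLabel w hw hw' (q ≫ q') v t (g' * g) := by
  intro e
  rw [mul_assoc, ← h e, ← h']
  exact congr_arg (fun e : (C.bundleCore w hw hw').proj ⁻¹' {z} => C.coord w hw hw' t e.1)
    ((C.isCoveringMap_proj w hw hw').monodromy_trans_apply q q' e)

theorem HasLabel.inv {x y : X} {q : FundamentalGroupoid.mk x ⟶ FundamentalGroupoid.mk y}
    {v u : V} {g : H} (h : C.HasLabel w hw hw' q v u g) :
    C.HasLabel w hw hw' (Groupoid.inv q) u v g⁻¹ := by
  intro e
  obtain ⟨e, rfl⟩ := ((C.isCoveringMap_proj w hw hw').monodromy_bijective q).2 e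
  rw [h e, inv_mul_cancel_left]
  have h1 := (C.isCoveringMap_proj w hw hw').monodromy_trans_apply q (Groupoid.inv q) e
  rw [← h1]
  have h2 : Path.Homotopic.Quotient.trans q (Groupoid.inv q) = .refl x := Groupoid.comp_inv q
  rw [h2, (C.isCoveringMap_proj w hw hw').monodromy_refl]
  rfl

/-- Left multiplication is free and the fibre is nonempty. Injectivity of the map from the free
group rests on this. -/
theorem HasLabel.unique {x y : X} {q : FundamentalGroupoid.mk x ⟶ FundamentalGroupoid.mk y}
    {v u : V} {g g' : H} (h : C.HasLabel w hw hw' q v u g) (h' : C.HasLabel w hw hw' q v u g') :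
    g = g' := by
  obtain ⟨e, -⟩ := C.coord_surjective w hw hw' v x 1
  exact mul_right_cancel ((h e).symm.trans (h' e))

variable (C)

theorem hasLabel_ray (v : V) (x : X) (hx : x ∈ C.star v) :
    C.HasLabel w hw hw' (C.ray v x hx) v v 1 := by
  intro e
  rw [one_mul]
  exact C.coord_monodromy_of_forall_mem w hw hw' _ (JoinedIn.somePath_mem _) e

theorem hasLabel_edge (v u : V) (x : X) (hv : x ∈ C.star v) (hu : x ∈ C.star u) :
    C.HasLabel w hw hw' (C.edge v u x hv hu) v u (w v u) := by
  -- The ray preserves the coordinate over the star of `v`; passing to that of `u` at its end-point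
  -- contributes the factor `w v u`.
  have h : C.HasLabel w hw hw' (C.ray v x hv) v u (w v u) := by
    intro e
    have h1 := C.hasLabel_ray (w := w) (hw := hw) (hw' := hw') v x hv e
    rw [one_mul] at h1
    rw [← h1]
    have hp : ((C.isCoveringMap_proj w hw hw').monodromy (C.ray v x hv) e).1.1 = x :=
      ((C.isCoveringMap_proj w hw hw').monodromy (C.ray v x hv) e).2
    refine C.coord_change w hw hw' _ ?_ ?_ <;> rwa [hp]
  simpa [edge] using h.comp (C.hasLabel_ray (w := w) (hw := hw) (hw' := hw') u x hu).inv

end Labels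

end StarCover
end

/-! ### Trees with chords and freeness of the fundamental group -/

noncomputable section

open CategoryTheory unitInterval

/-- A tree on `Fin (k + 1)` rooted at `0`, given by the parents of its vertices, together with
`n` chords. -/
structure TreeWithChords (k n : ℕ) where
  parent : Fin (k + 1) → Fin (k + 1)
  parent_lt : ∀ a, a ≠ 0 → parent a < a
  chord : Fin n → Fin (k + 1) × Fin (k + 1)
  chord_lt : ∀ i, (chord i).1 < (chord i).2
  chord_ne : ∀ i, (chord i).1 ≠ parent (chord i).2
  chord_injective : Function.Injective chord

namespace TreeWithChords

variable {k n : ℕ} (D : TreeWithChords k n)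

/-- The edges, oriented upwards. -/
def Rel (a b : Fin (k + 1)) : Prop := (b ≠ 0 ∧ a = D.parent b) ∨ ∃ i, D.chord i = (a, b)

theorem Rel.lt {D : TreeWithChords k n} {a b : Fin (k + 1)} (h : D.Rel a b) : a < b := by
  rcases h with ⟨h, rfl⟩ | ⟨i, h⟩
  · exact D.parent_lt b h
  · simpa [h] using D.chord_lt i

/-- The underlying graph. -/
def graph : SimpleGraph (Fin (k + 1)) where
  Adj a b := D.Rel a b ∨ D.Rel b a
  symm := ⟨fun _ _ => Or.symm⟩
  loopless := ⟨fun _ h => h.elim (fun h => h.lt.ne rfl) fun h => h.lt.ne rfl⟩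

open Classical in
/-- The oriented edges labelled by a free group: the `i`-th chord by the `i`-th generator, the
edges of the tree by `1`. -/
def label (v u : Fin (k + 1)) : FreeGroup (Fin n) :=
  if h : ∃ i, D.chord i = (v, u) then .of h.choose
  else if h : ∃ i, D.chord i = (u, v) then (.of h.choose)⁻¹ else 1

theorem label_chord (i : Fin n) {v u : Fin (k + 1)} (h : D.chord i = (v, u)) :
    D.label v u = .of i := by
  have h' : ∃ i, D.chord i = (v, u) := ⟨i, h⟩
  rw [label, dif_pos h', D.chord_injective (h'.choose_spec.trans h.symm)]

theorem not_chord_swap {v u : Fin (k + 1)} (h : ∃ i, D.chord i = (v, u)) :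
    ¬∃ i, D.chord i = (u, v) := by
  rintro ⟨j, hj⟩
  obtain ⟨i, hi⟩ := h
  have h1 := D.chord_lt i
  have h2 := D.chord_lt j
  rw [hi] at h1
  rw [hj] at h2
  exact lt_asymm h1 h2

theorem label_mul_label (v u : Fin (k + 1)) : D.label v u * D.label u v = 1 := by
  by_cases h : ∃ i, D.chord i = (v, u)
  · rw [label, dif_pos h, label, dif_neg (D.not_chord_swap h), dif_pos h, mul_inv_cancel]
  · by_cases h' : ∃ i, D.chord i = (u, v)
    · rw [label, dif_neg h, dif_pos h', label, dif_pos h', inv_mul_cancel]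
    · rw [label, dif_neg h, dif_neg h', label, dif_neg h', dif_neg h, mul_one]

theorem label_self (v : Fin (k + 1)) : D.label v v = 1 := by
  have h : ¬∃ i, D.chord i = (v, v) := by
    rintro ⟨i, h⟩
    have := D.chord_lt i
    rw [h] at this
    exact lt_irrefl _ this
  rw [label, dif_neg h, dif_neg h]

theorem label_parent (v : Fin (k + 1)) (hv : v ≠ 0) : D.label (D.parent v) v = 1 := by
  rw [label, dif_neg, dif_neg]
  · rintro ⟨i, h⟩
    have h1 := D.chord_lt i
    rw [h] at h1
    exact lt_asymm h1 (D.parent_lt v hv)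
  · rintro ⟨i, h⟩
    have := D.chord_ne i
    rw [h] at this
    exact this rfl

variable {X : Type*} [TopologicalSpace X] {C : StarCover X (Fin (k + 1))}

/-- The star cover has the given graph as its nerve. -/
def IsNerve (C : StarCover X (Fin (k + 1))) : Prop :=
  ∀ v u, v ≠ u → ((C.star v ∩ C.star u).Nonempty ↔ D.graph.Adj v u)

variable {D} (hC : D.IsNerve C)
include hC

theorem IsNerve.nonempty_parent {v : Fin (k + 1)} (hv : v ≠ 0) :
    (C.star (D.parent v) ∩ C.star v).Nonempty :=
  (hC _ _ (D.parent_lt v hv).ne).2 (Or.inl (Or.inl ⟨hv, rfl⟩))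

theorem IsNerve.nonempty_chord (i : Fin n) :
    (C.star (D.chord i).1 ∩ C.star (D.chord i).2).Nonempty :=
  (hC _ _ (D.chord_lt i).ne).2 (Or.inl (Or.inr ⟨i, rfl⟩))

/-- The path in the tree from the root. -/
def treePath (v : Fin (k + 1)) :
    FundamentalGroupoid.mk (C.center 0) ⟶ FundamentalGroupoid.mk (C.center v) :=
  if h : v = 0 then eqToHom (by rw [h])
  else treePath (D.parent v) ≫ C.edge (D.parent v) v (hC.nonempty_parent h).some
    (hC.nonempty_parent h).some_mem.1 (hC.nonempty_parent h).some_mem.2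
termination_by v
decreasing_by exact D.parent_lt v h

theorem treePath_zero : treePath hC 0 = 𝟙 _ := by
  rw [treePath, dif_pos rfl, eqToHom_refl]

theorem treePath_of_ne {v : Fin (k + 1)} (h : v ≠ 0) {x : X} (hp : x ∈ C.star (D.parent v))
    (hv : x ∈ C.star v) :
    treePath hC v = treePath hC (D.parent v) ≫ C.edge (D.parent v) v x hp hv := by
  rw [treePath, dif_neg h]
  exact congr_arg _ (C.edge_eq _ _ (D.parent_lt v h).ne _ _ _ _ _ _)

theorem hasLabel_treePath [TopologicalSpace (FreeGroup (Fin n))]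
    [DiscreteTopology (FreeGroup (Fin n))] (v : Fin (k + 1)) :
    C.HasLabel D.label D.label_self D.label_mul_label (treePath hC v) 0 v 1 := by
  have h : ∀ m : ℕ, ∀ v : Fin (k + 1), (v : ℕ) ≤ m →
      C.HasLabel D.label D.label_self D.label_mul_label (treePath hC v) 0 v 1 := by
    intro m
    induction m with
    | zero =>
      intro a ha
      obtain rfl : a = 0 := Fin.ext (Nat.le_zero.1 ha)
      rw [treePath_zero]
      exact C.hasLabel_id _ _
    | succ m ih =>
      intro a ha
      by_cases h0 : a = 0
      · subst h0
        rw [treePath_zero]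
        exact C.hasLabel_id _ _
      · obtain ⟨x, hx⟩ := hC.nonempty_parent h0
        rw [treePath_of_ne hC h0 hx.1 hx.2]
        have hp : (D.parent a : ℕ) < a := D.parent_lt a h0
        simpa [D.label_parent a h0] using (ih (D.parent a) (by omega)).comp
          (C.hasLabel_edge (D.parent a) a x hx.1 hx.2)
  exact h _ v le_rfl

theorem IsNerve.pathConnectedSpace : PathConnectedSpace X := by
  have h : ∀ x, Joined (C.center 0) x := fun x =>
    ⟨Quotient.out (treePath hC (C.index x) ≫ C.ray _ x (C.mem_star_index x))⟩
  exact ⟨⟨C.center 0⟩, fun x y => (h x).symm.trans (h y)⟩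

/-- The loop that runs through the tree to an edge, along it and back through the tree. -/
def edgeLoop (v u : Fin (k + 1)) (x : X) (hv : x ∈ C.star v) (hu : x ∈ C.star u) :
    FundamentalGroup X (C.center 0) :=
  treePath hC v ≫ C.edge v u x hv hu ≫ Groupoid.inv (treePath hC u)

theorem edgeLoop_inv (v u : Fin (k + 1)) (x : X) (hv : x ∈ C.star v) (hu : x ∈ C.star u) :
    (edgeLoop hC v u x hv hu)⁻¹ = edgeLoop hC u v x hu hv := by
  refine inv_eq_of_mul_eq_one_right ?_
  rw [edgeLoop, edgeLoop, End.mul_def, ← C.edge_inv v u x hv hu]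
  simp [Groupoid.inv_eq_inv, End.one_def]

theorem edgeLoop_parent (v : Fin (k + 1)) (h : v ≠ 0) (x : X) (hp : x ∈ C.star (D.parent v))
    (hv : x ∈ C.star v) : edgeLoop hC (D.parent v) v x hp hv = 1 := by
  rw [edgeLoop, treePath_of_ne hC h hp hv]
  simp [Groupoid.inv_eq_inv, End.one_def]

theorem edgeLoop_eq {v u : Fin (k + 1)} (hvu : v ≠ u) {x y : X} (hv : x ∈ C.star v)
    (hu : x ∈ C.star u) (hv' : y ∈ C.star v) (hu' : y ∈ C.star u) :
    edgeLoop hC v u x hv hu = edgeLoop hC v u y hv' hu' := by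
  rw [edgeLoop, edgeLoop, C.edge_eq v u hvu x y hv hu hv' hu']

/-- The loop of a chord. -/
def chordLoop (i : Fin n) : FundamentalGroup X (C.center 0) :=
  edgeLoop hC (D.chord i).1 (D.chord i).2 (hC.nonempty_chord i).some
    (hC.nonempty_chord i).some_mem.1 (hC.nonempty_chord i).some_mem.2

/-- It suffices that the range contains every edge loop: those of tree edges are trivial, those of
chords are images of generators, and reversed edges give inverses. The nerve condition excludes
other edges. -/
theorem lift_chordLoop_surjective : Function.Surjective (FreeGroup.lift (chordLoop hC)) := by
  rw [← MonoidHom.range_eq_top]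
  set S := (FreeGroup.lift (chordLoop hC)).range
  have hchord : ∀ i v u x hv hu, D.chord i = (v, u) → edgeLoop hC v u x hv hu ∈ S := by
    intro i v u x hv hu h
    refine ⟨.of i, ?_⟩
    rw [FreeGroup.lift_apply_of, chordLoop]
    obtain ⟨rfl, rfl⟩ := Prod.mk.inj h
    exact edgeLoop_eq hC (D.chord_lt i).ne _ _ _ _
  have hrel : ∀ v u x hv hu, D.Rel v u → edgeLoop hC v u x hv hu ∈ S := by
    rintro v u x hv hu (⟨h, rfl⟩ | ⟨i, h⟩)
    · rw [edgeLoop_parent hC u h]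
      exact S.one_mem
    · exact hchord i v u x hv hu h
  refine StarCover.eq_top_of_edge_mem (C := C) (τ := treePath hC) ?_ (treePath_zero hC)
  intro v u x hv hu
  change edgeLoop hC v u x hv hu ∈ S
  by_cases hvu : v = u
  · subst hvu
    convert S.one_mem
    rw [edgeLoop, C.edge_self]
    simp [Groupoid.inv_eq_inv, End.one_def]
  · rcases (hC v u hvu).1 ⟨x, hv, hu⟩ with h | h
    · exact hrel v u x hv hu h
    · rw [← edgeLoop_inv]
      exact S.inv_mem (hrel u v x hu hv h)

theorem hasLabel_lift_chordLoop [TopologicalSpace (FreeGroup (Fin n))]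
    [DiscreteTopology (FreeGroup (Fin n))] (g : FreeGroup (Fin n)) :
    C.HasLabel D.label D.label_self D.label_mul_label (FreeGroup.lift (chordLoop hC) g) 0 0 g := by
  have hof : ∀ i, C.HasLabel D.label D.label_self D.label_mul_label
      (FreeGroup.lift (chordLoop hC) (.of i)) 0 0 (.of i) := by
    intro i
    rw [FreeGroup.lift_apply_of]
    have := ((hasLabel_treePath hC (D.chord i).1).comp (C.hasLabel_edge (D.chord i).1 (D.chord i).2
      (hC.nonempty_chord i).some (hC.nonempty_chord i).some_mem.1
      (hC.nonempty_chord i).some_mem.2)).comp (hasLabel_treePath hC (D.chord i).2).inv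
    rw [D.label_chord i rfl] at this
    simpa [chordLoop, edgeLoop] using this
  induction g using FreeGroup.induction_on with
  | C1 =>
    rw [map_one]
    exact C.hasLabel_id _ _
  | of i => exact hof i
  | inv_of i h =>
    rw [map_inv]
    exact h.inv
  | mul g g' h h' =>
    rw [map_mul]
    -- Both the product of path classes and the product of labels reverse the order of composition,
    -- so the two agree.
    exact h'.comp h

/-- A word can be recovered from its loop as the label of the monodromy. -/
theorem lift_chordLoop_injective : Function.Injective (FreeGroup.lift (chordLoop hC)) := by
  let _ : TopologicalSpace (FreeGroup (Fin n)) := ⊥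
  have : DiscreteTopology (FreeGroup (Fin n)) := ⟨rfl⟩
  intro g g' h
  have h1 := hasLabel_lift_chordLoop hC g
  rw [h] at h1
  exact h1.unique (hasLabel_lift_chordLoop hC g')

/-- The fundamental group of a space covered by stars is free on the chords of the nerve. -/
def fundamentalGroupEquiv : FreeGroup (Fin n) ≃* FundamentalGroup X (C.center 0) :=
  MulEquiv.ofBijective _ ⟨lift_chordLoop_injective hC, lift_chordLoop_surjective hC⟩

end TreeWithChords
end

/-! ### Open stars of a realized graph -/

noncomputable section

namespace GraphRealization

open AffineMap

variable {V : Type*} [Finite V] {G : SimpleGraph V} {N : ℕ} (P : GraphRealization G N)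

/-- The open star of a vertex: the vertex and the half-open edges that start from it. -/
def openStar (v : V) : Set (EuclideanSpace ℝ (Fin N)) :=
  {x | x = P.point v ∨
    ∃ u, G.Adj v u ∧ ∃ t ∈ Set.Ico (0 : ℝ) 1, lineMap (P.point v) (P.point u) t = x}

theorem lineMap_mem_segment (v u : V) {t : ℝ} (h0 : 0 ≤ t) (h1 : t ≤ 1) :
    lineMap (P.point v) (P.point u) t ∈ segment ℝ (P.point v) (P.point u) := by
  rw [segment_eq_image_lineMap]
  exact ⟨t, ⟨h0, h1⟩, rfl⟩

theorem lineMap_ne_right {v u : V} (h : G.Adj v u) {t : ℝ} (ht : t < 1) :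
    lineMap (P.point v) (P.point u) t ≠ P.point u := by
  intro h'
  refine ht.ne (lineMap_injective ℝ (P.point_injective.ne h.ne) ?_)
  rw [h', lineMap_apply_one]

theorem eq_of_point_mem_openStar {v w : V} (h : P.point w ∈ P.openStar v) : w = v := by
  rcases h with h | ⟨u, hu, t, ht, h⟩
  · exact P.point_injective h
  · have := P.vertex_edge w v u hu (h ▸ P.lineMap_mem_segment v u ht.1 ht.2.le)
    rcases Sym2.mem_iff.1 this with rfl | rfl
    · rfl
    · exact absurd h (P.lineMap_ne_right hu ht.2)

theorem point_mem_openStar (v : V) : P.point v ∈ P.openStar v := Or.inl rfl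

theorem starConvex_openStar (v : V) : StarConvex ℝ (P.point v) (P.openStar v) := by
  rw [starConvex_iff_segment_subset]
  rintro x hx y hy
  rw [segment_eq_image_lineMap] at hy
  obtain ⟨s, hs, rfl⟩ := hy
  rcases hx with rfl | ⟨u, hu, t, ht, rfl⟩
  · exact Or.inl (by simp)
  · refine Or.inr ⟨u, hu, s * t, ⟨mul_nonneg hs.1 ht.1, ?_⟩, ?_⟩
    · exact (mul_le_of_le_one_left ht.1 hs.2).trans_lt ht.2
    · simp [lineMap_apply, mul_smul]

theorem openStar_subset_carrier (v : V) : P.openStar v ⊆ P.carrier := by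
  rintro x (rfl | ⟨u, hu, t, ht, rfl⟩)
  · exact Or.inl ⟨v, rfl⟩
  · exact Or.inr (Set.mem_iUnion₂.2 ⟨(v, u), hu, P.lineMap_mem_segment v u ht.1 ht.2.le⟩)

/-- If the half-open edges through `x` belonged to different edges, `x` would be a vertex; but a
star contains no vertex other than its own, which would force `v = u`. -/
theorem adj_and_mem_openSegment {v u : V} (hvu : v ≠ u) {x : EuclideanSpace ℝ (Fin N)}
    (hv : x ∈ P.openStar v) (hu : x ∈ P.openStar u) :
    G.Adj v u ∧ x ∈ openSegment ℝ (P.point v) (P.point u) := by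
  rcases hv with rfl | ⟨a, ha, t, ht, rfl⟩
  · exact absurd (P.eq_of_point_mem_openStar hu) hvu
  rcases hu with hu | ⟨b, hb, s, hs, h⟩
  · refine absurd (P.eq_of_point_mem_openStar (v := v) (w := u) ?_).symm hvu
    rw [← hu]
    exact Or.inr ⟨a, ha, t, ht, rfl⟩
  by_cases he : s(v, a) = s(u, b)
  · rcases Sym2.eq_iff.1 he with ⟨rfl, -⟩ | ⟨rfl, rfl⟩
    · exact absurd rfl hvu
    · refine ⟨ha, ?_⟩
      rw [openSegment_eq_image_lineMap]
      refine ⟨t, ⟨ht.1.lt_of_ne ?_, ht.2⟩, rfl⟩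
      rintro rfl
      rw [lineMap_apply_zero] at h
      exact P.lineMap_ne_right hb hs.2 h
  · obtain ⟨w, h1, h2, h3⟩ := P.edge_inter v a u b ha hb he _
      ⟨P.lineMap_mem_segment v a ht.1 ht.2.le, h ▸ P.lineMap_mem_segment u b hs.1 hs.2.le⟩
    have hwv : w = v := P.eq_of_point_mem_openStar (h3 ▸ Or.inr ⟨a, ha, t, ht, rfl⟩)
    have hwu : w = u := P.eq_of_point_mem_openStar (h3 ▸ Or.inr ⟨b, hb, s, hs, h⟩)
    exact absurd (hwv.symm.trans hwu) hvu

theorem openSegment_subset_openStar {v u : V} (h : G.Adj v u) :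
    openSegment ℝ (P.point v) (P.point u) ⊆ P.openStar v := by
  intro x hx
  rw [openSegment_eq_image_lineMap] at hx
  obtain ⟨t, ht, rfl⟩ := hx
  exact Or.inr ⟨u, h, t, ⟨ht.1.le, ht.2⟩, rfl⟩

theorem openSegment_subset_inter {v u : V} (h : G.Adj v u) :
    openSegment ℝ (P.point v) (P.point u) ⊆ P.openStar v ∩ P.openStar u :=
  Set.subset_inter (P.openSegment_subset_openStar h)
    (openSegment_symm ℝ (P.point v) (P.point u) ▸ P.openSegment_subset_openStar h.symm)

/-- Otherwise `x` would lie on two different edges, hence be a vertex, and it would be the center of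
two different stars. -/
theorem openStar_triple {v u t : V} {x : EuclideanSpace ℝ (Fin N)} (hv : x ∈ P.openStar v)
    (hu : x ∈ P.openStar u) (ht : x ∈ P.openStar t) : v = u ∨ u = t ∨ v = t := by
  by_contra! h
  obtain ⟨h1, h1'⟩ := P.adj_and_mem_openSegment h.1 hv hu
  obtain ⟨h2, h2'⟩ := P.adj_and_mem_openSegment h.2.1 hu ht
  obtain ⟨w, -, -, rfl⟩ := P.edge_inter v u u t h1 h2 (fun he => by
    rcases Sym2.eq_iff.1 he with ⟨h', -⟩ | ⟨h', -⟩
    exacts [h.1 h', h.2.2 h']) x ⟨openSegment_subset_segment _ _ _ h1',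
      openSegment_subset_segment _ _ _ h2'⟩
  exact h.1 ((P.eq_of_point_mem_openStar hv).symm.trans (P.eq_of_point_mem_openStar hu))

theorem exists_mem_openStar {x : EuclideanSpace ℝ (Fin N)} (hx : x ∈ P.carrier) :
    ∃ v, x ∈ P.openStar v := by
  rcases hx with ⟨v, rfl⟩ | hx
  · exact ⟨v, P.point_mem_openStar v⟩
  · obtain ⟨⟨v, u⟩, h, hx⟩ := Set.mem_iUnion₂.1 hx
    rw [segment_eq_image_lineMap] at hx
    obtain ⟨t, ht, rfl⟩ := hx
    rcases ht.2.eq_or_lt with rfl | ht'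
    · exact ⟨u, Or.inl (lineMap_apply_one _ _)⟩
    · exact ⟨v, Or.inr ⟨u, h, t, ⟨ht.1, ht'⟩, rfl⟩⟩

/-- The part of the realization that avoids the open star of a vertex. -/
def antistar (v : V) : Set (EuclideanSpace ℝ (Fin N)) :=
  P.point '' {u | u ≠ v} ∪
    ⋃ e ∈ {e : V × V | G.Adj e.1 e.2 ∧ v ∉ s(e.1, e.2)}, segment ℝ (P.point e.1) (P.point e.2)

theorem isClosed_antistar (v : V) : IsClosed (P.antistar v) := by
  refine ((Set.toFinite _).image _).isClosed.union ?_
  refine (Set.toFinite _).isClosed_biUnion fun e _ => ?_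
  rw [segment_eq_image_lineMap]
  exact (isCompact_Icc.image (lineMap_continuous (R := ℝ))).isClosed

/-- This yields openness of the stars in the realization, the antistar being closed as a finite
union of points and segments. -/
theorem mem_openStar_iff_notMem_antistar {v : V} {x : EuclideanSpace ℝ (Fin N)}
    (hx : x ∈ P.carrier) : x ∈ P.openStar v ↔ x ∉ P.antistar v := by
  constructor
  · rintro h (⟨u, hu, rfl⟩ | h')
    · exact hu (P.eq_of_point_mem_openStar h)
    · obtain ⟨⟨a, b⟩, ⟨hab, hv⟩, hx'⟩ := Set.mem_iUnion₂.1 h'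
      have h₀ := h
      rcases h with rfl | ⟨u, hu, t, ht, rfl⟩
      · exact hv (P.vertex_edge v a b hab hx')
      · obtain ⟨w, -, hw, hw'⟩ := P.edge_inter v u a b hu hab
          (fun he => hv (he ▸ Sym2.mem_mk_left v u)) _
          ⟨P.lineMap_mem_segment v u ht.1 ht.2.le, hx'⟩
        exact hv (P.eq_of_point_mem_openStar (hw' ▸ h₀) ▸ hw)
  · intro h
    rcases hx with ⟨u, rfl⟩ | hx
    · by_cases huv : u = v
      · exact Or.inl (huv ▸ rfl)
      · exact absurd (Or.inl ⟨u, huv, rfl⟩) h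
    · obtain ⟨⟨a, b⟩, hab, hx'⟩ := Set.mem_iUnion₂.1 hx
      have key : ∀ u, G.Adj v u → x ∈ segment ℝ (P.point v) (P.point u) → x ∈ P.openStar v := by
        intro u hu hx
        rw [segment_eq_image_lineMap] at hx
        obtain ⟨t, ht, rfl⟩ := hx
        rcases ht.2.eq_or_lt with rfl | ht'
        · exact absurd (Or.inl ⟨u, hu.ne', (lineMap_apply_one _ _).symm⟩) h
        · exact Or.inr ⟨u, hu, t, ⟨ht.1, ht'⟩, rfl⟩
      by_cases hv : v ∈ s(a, b)
      · rcases Sym2.mem_iff.1 hv with rfl | rfl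
        · exact key b hab hx'
        · exact key a hab.symm (segment_symm ℝ (P.point v) (P.point a) ▸ hx')
      · exact absurd (Or.inr (Set.mem_iUnion₂.2 ⟨(a, b), ⟨hab, hv⟩, hx'⟩)) h

theorem image_preimage_openStar (v : V) :
    ((↑) : P.carrier → _) '' ((↑) ⁻¹' P.openStar v) = P.openStar v := by
  rw [Subtype.image_preimage_coe, Set.inter_eq_right]
  exact P.openStar_subset_carrier v

/-- A realized graph is covered by the open stars of its vertices. -/
def starCover : StarCover P.carrier V where
  star v := ((↑) : P.carrier → EuclideanSpace ℝ (Fin N)) ⁻¹' P.openStar v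
  isOpen_star v := by
    have : ((↑) ⁻¹' P.openStar v : Set P.carrier) = ((↑) ⁻¹' P.antistar v)ᶜ := by
      ext x
      exact P.mem_openStar_iff_notMem_antistar x.2
    rw [this]
    exact ((P.isClosed_antistar v).preimage continuous_subtype_val).isOpen_compl
  index x := (P.exists_mem_openStar x.2).choose
  mem_star_index x := (P.exists_mem_openStar x.2).choose_spec
  center v := ⟨P.point v, Or.inl ⟨v, rfl⟩⟩
  center_mem v := P.point_mem_openStar v
  isSimplyConnected_star v := by
    rw [← Topology.IsEmbedding.subtypeVal.isSimplyConnected_image, P.image_preimage_openStar v]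
    have := (P.starConvex_openStar v).contractibleSpace ⟨_, P.point_mem_openStar v⟩
    exact SimplyConnectedSpace.ofContractible _
  joinedIn_inter v u hvu x hx y hy := by
    obtain ⟨h, hx'⟩ := P.adj_and_mem_openSegment hvu hx.1 hx.2
    obtain ⟨-, hy'⟩ := P.adj_and_mem_openSegment hvu hy.1 hy.2
    rw [← Topology.IsEmbedding.subtypeVal.isInducing.joinedIn_image hx hy]
    have hj : JoinedIn (openSegment ℝ (P.point v) (P.point u)) (x : EuclideanSpace ℝ (Fin N)) y :=
      ((convex_openSegment _ _).isPathConnected ⟨_, hx'⟩).joinedIn _ hx' _ hy'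
    refine hj.mono fun z hz => ?_
    have hz' := P.openSegment_subset_inter h hz
    exact ⟨⟨z, P.openStar_subset_carrier v hz'.1⟩, hz', rfl⟩
  triple_inter _ _ _ _ := P.openStar_triple

theorem starCover_inter_nonempty_iff {v u : V} (hvu : v ≠ u) :
    (P.starCover.star v ∩ P.starCover.star u).Nonempty ↔ G.Adj v u := by
  constructor
  · rintro ⟨x, hv, hu⟩
    exact (P.adj_and_mem_openSegment hvu hv hu).1
  · intro h
    have hm : lineMap (P.point v) (P.point u) (1 / 2 : ℝ) ∈
        openSegment ℝ (P.point v) (P.point u) := by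
      rw [openSegment_eq_image_lineMap]
      exact ⟨1 / 2, by norm_num, rfl⟩
    have hm' := P.openSegment_subset_inter h hm
    exact ⟨⟨_, P.openStar_subset_carrier v hm'.1⟩, hm'⟩

/-- Renaming the vertices of a realized graph. -/
def relabel {W : Type*} [Finite W] {G' : SimpleGraph W} (φ : G' ≃g G) : GraphRealization G' N where
  point v := P.point (φ v)
  point_injective := P.point_injective.comp φ.injective
  edge_inter v w v' w' h h' hne x hx := by
    obtain ⟨u, hu, hu', rfl⟩ := P.edge_inter (φ v) (φ w) (φ v') (φ w') (φ.map_adj_iff.2 h)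
      (φ.map_adj_iff.2 h') (fun he => hne (Sym2.map.injective φ.injective (by simpa using he))) x hx
    refine ⟨φ.symm u, ?_, ?_, by simp⟩
    · rcases Sym2.mem_iff.1 hu with rfl | rfl <;> simp
    · rcases Sym2.mem_iff.1 hu' with rfl | rfl <;> simp
  vertex_edge u v w h hx := by
    have := P.vertex_edge (φ u) (φ v) (φ w) (φ.map_adj_iff.2 h) hx
    rcases Sym2.mem_iff.1 this with h | h
    · exact φ.injective h ▸ Sym2.mem_mk_left _ _
    · exact φ.injective h ▸ Sym2.mem_mk_right _ _

end GraphRealization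

/-- Renaming the members of a star cover. -/
def StarCover.reindex {X V W : Type*} [TopologicalSpace X] (C : StarCover X V) (e : W ≃ V) :
    StarCover X W where
  star w := C.star (e w)
  isOpen_star w := C.isOpen_star (e w)
  index x := e.symm (C.index x)
  mem_star_index x := by simpa using C.mem_star_index x
  center w := C.center (e w)
  center_mem w := C.center_mem (e w)
  isSimplyConnected_star w := C.isSimplyConnected_star (e w)
  joinedIn_inter w w' h := C.joinedIn_inter (e w) (e w') (e.injective.ne h)
  triple_inter u v w x hu hv hw := by
    simpa only [e.injective.eq_iff] using C.triple_inter (e u) (e v) (e w) x hu hv hw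

/-- The fundamental group of a realized graph is free on the chords of a rooted tree. -/
theorem TreeWithChords.nonempty_fundamentalGroup_mulEquiv {k n N : ℕ} (D : TreeWithChords k n)
    {V : Type*} [Finite V] {G : SimpleGraph V} (φ : D.graph ≃g G) (P : GraphRealization G N)
    (x : P.carrier) : Nonempty (FundamentalGroup P.carrier x ≃* FreeGroup (Fin n)) := by
  have hC : D.IsNerve (P.starCover.reindex φ.toEquiv) := fun v u hvu =>
    (P.starCover_inter_nonempty_iff (φ.injective.ne hvu)).trans φ.map_adj_iff
  -- The spanning tree makes the realization path connected, so the base point may be moved to the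
  -- root.
  have := hC.pathConnectedSpace
  exact ⟨(FundamentalGroup.fundamentalGroupMulEquivOfPathConnected _ _).trans
    (fundamentalGroupEquiv hC).symm⟩

theorem GraphRealization.complexity_eq {V : Type*} [Finite V] {G : SimpleGraph V} {N n : ℕ}
    {P : GraphRealization G N} {x : P.carrier}
    (h : Nonempty (FundamentalGroup P.carrier x ≃* FreeGroup (Fin n))) : P.complexity x = n :=
  h.elim fun e => numFreeGenerators_eq ⟨e⟩

end

noncomputable section

/-! ### Planar realizations with vertices on a parabola -/

/-- The affine form on the left vanishes on the line through the points of the parabola with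
abscissae `x` and `y`, and takes the value `(a - x) * (a - y)` at the one with abscissa `a`. -/
theorem mem_segment_parabola {a b x y : ℝ} {p : EuclideanSpace ℝ (Fin 2)}
    (hp : p ∈ segment ℝ !₂[a, a ^ 2] !₂[b, b ^ 2]) :
    ∃ t ∈ Set.Icc (0 : ℝ) 1, p = AffineMap.lineMap !₂[a, a ^ 2] !₂[b, b ^ 2] t ∧
      p 1 - (x + y) * p 0 + x * y = (1 - t) * ((a - x) * (a - y)) + t * ((b - x) * (b - y)) := by
  rw [segment_eq_image_lineMap] at hp
  obtain ⟨t, ht, rfl⟩ := hp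
  refine ⟨t, ht, rfl, ?_⟩
  simp [AffineMap.lineMap_apply]
  ring

/-- A graph whose vertices can be placed on a parabola without crossing edges has a realization in
the plane. -/
def GraphRealization.ofParabola {V : Type*} [Finite V] (G : SimpleGraph V) (pos : V → ℝ)
    (hpos : Function.Injective pos)
    (h : ∀ v w v' w', G.Adj v w → G.Adj v' w' → 0 ≤ ((pos v' - pos v) * (pos v' - pos w)) *
      ((pos w' - pos v) * (pos w' - pos w))) : GraphRealization G 2 where
  point v := !₂[pos v, pos v ^ 2]
  point_injective v w hvw := hpos (by simpa using congr_arg (fun p => p.ofLp 0) hvw)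
  edge_inter v w v' w' hvw hvw' hne x hx := by
    have hend : ∀ u, (pos u - pos v) * (pos u - pos w) = 0 → u ∈ s(v, w) := by
      intro u hu
      rcases mul_eq_zero.1 hu with h0 | h0
      · exact hpos (sub_eq_zero.1 h0) ▸ Sym2.mem_mk_left v w
      · exact hpos (sub_eq_zero.1 h0) ▸ Sym2.mem_mk_right v w
    obtain ⟨s, -, -, hs⟩ := mem_segment_parabola (x := pos v) (y := pos w) hx.1
    obtain ⟨t, ht, hxt, ht'⟩ := mem_segment_parabola (x := pos v) (y := pos w) hx.2
    have hzero := ht'.symm.trans hs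
    simp only [sub_self, zero_mul, mul_zero, add_zero] at hzero
    have hprod := h v w v' w' hvw hvw'
    -- `A` and `B` are the values of the affine form of the first edge at the ends of the second;
    -- `hprod` says that they do not have opposite strict signs.
    set A := (pos v' - pos v) * (pos v' - pos w)
    set B := (pos w' - pos v) * (pos w' - pos w)
    rcases ht.1.eq_or_lt with rfl | h0
    · refine ⟨v', hend v' ?_, Sym2.mem_mk_left _ _, by simpa using hxt⟩
      simpa only [sub_zero, one_mul, zero_mul, add_zero] using hzero
    rcases ht.2.eq_or_lt with rfl | h1
    · refine ⟨w', hend w' ?_, Sym2.mem_mk_right _ _, by simpa using hxt⟩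
      simpa only [sub_self, one_mul, zero_mul, zero_add] using hzero
    -- At an interior point `(1 - t) * A + t * B = 0`. Multiplied by `A`, both terms are
    -- nonnegative, so `A` and then `B` vanish and the two edges coincide.
    have hA : A = 0 := by
      have : (1 - t) * A ^ 2 + t * (A * B) = 0 := by linear_combination A * hzero
      have h2 : 0 ≤ t * (A * B) := mul_nonneg h0.le hprod
      have h3 : (1 - t) * A ^ 2 = 0 :=
        le_antisymm (by linarith) (mul_nonneg (sub_nonneg.2 h1.le) (sq_nonneg A))
      simpa [(sub_pos.2 h1).ne'] using h3
    have hB : B = 0 := by simpa [hA, h0.ne'] using hzero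
    exact absurd ((Sym2.mem_and_mem_iff hvw'.ne).1 ⟨hend v' hA, hend w' hB⟩) hne
  vertex_edge u v w _ hu := by
    obtain ⟨s, -, -, hs⟩ := mem_segment_parabola (x := pos v) (y := pos w) hu
    have h0 : (pos u - pos v) * (pos u - pos w) = 0 := by
      have hs' : pos u ^ 2 - (pos v + pos w) * pos u + pos v * pos w = 0 := by simpa using hs
      linear_combination hs'
    rcases mul_eq_zero.1 h0 with h0 | h0
    · exact hpos (sub_eq_zero.1 h0) ▸ Sym2.mem_mk_left v w
    · exact hpos (sub_eq_zero.1 h0) ▸ Sym2.mem_mk_right v w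

theorem GraphRealization.nonempty_of_parabola {V : Type*} [Finite V] (G : SimpleGraph V)
    (pos : V → ℤ) (hpos : Function.Injective pos)
    (h : ∀ v w, G.Adj v w → ∀ v' w', G.Adj v' w' →
      0 ≤ ((pos v' - pos v) * (pos v' - pos w)) * ((pos w' - pos v) * (pos w' - pos w))) :
    Nonempty (GraphRealization G 2) :=
  ⟨.ofParabola G (fun v => (pos v : ℝ)) (fun _ _ h => hpos (Int.cast_injective h))
    fun v w v' w' hvw hvw' => by exact_mod_cast h v w hvw v' w' hvw'⟩

/-! ### Degrees of the modes with a given base-chord -/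

theorem pitchClass_eq_iff {a b : ℤ} :
    (((a : ℝ) : PitchClass) = ((b : ℝ) : PitchClass)) ↔ a ≡ b [ZMOD 12] := by
  rw [← sub_eq_zero, ← AddCircle.coe_sub, AddCircle.coe_eq_zero_iff, Int.modEq_comm,
    Int.modEq_iff_dvd]
  constructor
  · rintro ⟨n, hn⟩
    refine ⟨n, ?_⟩
    have : ((n * 12 : ℤ) : ℝ) = ((a - b : ℤ) : ℝ) := by simpa using hn
    rw [← Int.cast_injective this, mul_comm]
  · rintro ⟨n, hn⟩
    refine ⟨n, ?_⟩
    have : ((a - b : ℤ) : ℝ) = ((12 * n : ℤ) : ℝ) := by rw [hn]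
    push_cast at this
    rw [zsmul_eq_mul, this, mul_comm]

/-- The `i`-th note of a parent scale played from degree `t`, in semitones above its first note. -/
def ParentScale.interval (s : ParentScale) (t i : Fin 7) : ℤ :=
  s.semitones (t + i) - s.semitones t

/-- The parent scale `s`, played from degree `t`, has a base-chord of type `c`. -/
def ParentScale.Carries (s : ParentScale) (t : Fin 7) (c : ChordType) : Prop :=
  ∀ j : Fin 4, s.interval t (![0, 2, 4, 6] j) ≡ c.semitones j [ZMOD 12]

instance (s : ParentScale) (t : Fin 7) (c : ChordType) : Decidable (s.Carries t c) :=
  inferInstanceAs (Decidable (∀ _, _))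

instance : Fintype ParentScale where
  elems := ⟨([.major, .melodicMinor, .harmonicMinor] : List ParentScale), by simp⟩
  complete s := by cases s <;> simp

/-- The note `k` semitones above the root occurs as the `i`-th degree of a mode with a base-chord
of type `c`. -/
def ChordType.HasDegree (c : ChordType) (i : Fin 7) (k : ℤ) : Prop :=
  ∃ s : ParentScale, ∃ t, s.Carries t c ∧ s.interval t i ≡ k [ZMOD 12]

instance (c : ChordType) (i : Fin 7) (k : ℤ) : Decidable (c.HasDegree i k) :=
  inferInstanceAs (Decidable (∃ _, _))

theorem MusicalMode.note_eq (m : MusicalMode) (i : Fin 7) :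
    m.note i = m.note 0 + ((m.scale.interval m.start i : ℝ) : PitchClass) := by
  simp [MusicalMode.note, ParentScale.interval]

theorem ChordType.semitones_zero (c : ChordType) : c.semitones 0 = 0 := by
  cases c <;> rfl

theorem MusicalMode.baseChord_apply (m : MusicalMode) (j : Fin 4) :
    m.baseChord j = m.note (![0, 2, 4, 6] j) := by
  fin_cases j <;> rfl

theorem MusicalMode.baseChord_eq_iff (m : MusicalMode) (c : ChordType) (r : PitchClass) :
    m.baseChord = seventhChord c r ↔ m.note 0 = r ∧ m.scale.Carries m.start c := by
  have h0 : m.baseChord = seventhChord c r → m.note 0 = r := fun h => by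
    simpa [seventhChord, c.semitones_zero, MusicalMode.baseChord] using congr_fun h 0
  have key : m.note 0 = r → (m.baseChord = seventhChord c r ↔ m.scale.Carries m.start c) := by
    rintro rfl
    refine funext_iff.trans (forall_congr' fun j => ?_)
    rw [m.baseChord_apply, m.note_eq, seventhChord, add_right_inj, pitchClass_eq_iff]
  exact ⟨fun h => ⟨h0 h, (key (h0 h)).1 h⟩, fun h => (key h.1).2 h.2⟩

theorem isDegree_iff {c : ChordType} {r v : PitchClass} {i : Fin 7} :
    IsDegree (seventhChord c r) i v ↔ ∃ s : ParentScale, ∃ t, s.Carries t c ∧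
      r + ((s.interval t i : ℝ) : PitchClass) = v := by
  constructor
  · rintro ⟨m, hm, rfl⟩
    obtain ⟨rfl, hm'⟩ := (m.baseChord_eq_iff c r).1 hm
    exact ⟨_, _, hm', (m.note_eq i).symm⟩
  · rintro ⟨s, t, h, rfl⟩
    -- The tonic is chosen so that degree `t` of the scale falls on `r`.
    have h0 : (MusicalMode.mk s (r - ((s.semitones t : ℝ) : PitchClass)) t).note 0 = r := by
      simp [MusicalMode.note]
    refine ⟨⟨s, r - ((s.semitones t : ℝ) : PitchClass), t⟩,
      (MusicalMode.baseChord_eq_iff _ c r).2 ⟨h0, h⟩, ?_⟩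
    rw [MusicalMode.note_eq, h0]

/-- The root cancels, which leaves a decidable statement about integers modulo 12. -/
theorem isDegree_add_iff {c : ChordType} {r : PitchClass} {i : Fin 7} {k : ℤ} :
    IsDegree (seventhChord c r) i (r + ((k : ℝ) : PitchClass)) ↔ c.HasDegree i k := by
  simp only [isDegree_iff, ChordType.HasDegree, add_right_inj, pitchClass_eq_iff]

theorem mem_baseChordNotes_iff {c : ChordType} (hc : ∃ s : ParentScale, ∃ t, s.Carries t c)
    {r v : PitchClass} :
    v ∈ baseChordNotes (seventhChord c r) ↔ ∃ i, IsDegree (seventhChord c r) i v := by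
  constructor
  · rintro (⟨j, rfl⟩ | hv)
    · obtain ⟨s, t, h⟩ := hc
      refine ⟨![0, 2, 4, 6] j, isDegree_iff.2 ⟨s, t, h, ?_⟩⟩
      rw [seventhChord, add_right_inj, pitchClass_eq_iff]
      exact h j
    · obtain ⟨m, hm, j, rfl⟩ := Set.mem_iUnion₂.1 hv
      refine ⟨![1, 3, 5] j, m, hm, ?_⟩
      fin_cases j <;> rfl
  · rintro ⟨i, m, hm, rfl⟩
    have hB : ∀ j, m.baseChord j ∈ baseChordNotes (seventhChord c r) := fun j =>
      Or.inl ⟨j, (congr_fun hm j).symm⟩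
    have hT : ∀ j, m.tensionTriad j ∈ baseChordNotes (seventhChord c r) := fun j =>
      Or.inr (Set.mem_iUnion₂.2 ⟨m, hm, j, rfl⟩)
    fin_cases i
    exacts [hB 0, hT 0, hB 1, hT 1, hB 2, hT 2, hB 3]

/-! ### The base-chord graphs as trees with chords -/

namespace TreeWithChords

variable {k n : ℕ}

instance (D : TreeWithChords k n) : DecidableRel D.graph.Adj := fun a b =>
  inferInstanceAs (Decidable
    (((b ≠ 0 ∧ a = D.parent b) ∨ ∃ i, D.chord i = (a, b)) ∨
      ((a ≠ 0 ∧ b = D.parent a) ∨ ∃ i, D.chord i = (b, a))))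

/-- The vertices of a tree with chords are the notes `semitone a` above the root of a chord of
type `c`, and its edges are those of the base-chord graph. -/
structure Models (D : TreeWithChords k n) (c : ChordType) (semitone : Fin (k + 1) → ℤ) : Prop where
  injective : ∀ a b, semitone a ≡ semitone b [ZMOD 12] → a = b
  hasDegree : ∀ a, ∃ i, c.HasDegree i (semitone a)
  exists_eq : ∀ (s : ParentScale) (t : Fin 7), s.Carries t c → ∀ i, ∃ a,
    s.interval t i ≡ semitone a [ZMOD 12]
  adj_iff : ∀ a b, D.graph.Adj a b ↔ a ≠ b ∧
    ((∃ i : Fin 6, c.HasDegree i.castSucc (semitone a) ∧ c.HasDegree i.succ (semitone b)) ∨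
      ∃ i : Fin 6, c.HasDegree i.castSucc (semitone b) ∧ c.HasDegree i.succ (semitone a))

theorem Models.nonempty_iso {D : TreeWithChords k n} {c : ChordType}
    {semitone : Fin (k + 1) → ℤ} (h : D.Models c semitone) (r : PitchClass) :
    Nonempty (D.graph ≃g baseChordGraph (seventhChord c r)) := by
  have hc : ∃ s : ParentScale, ∃ t, s.Carries t c := by
    obtain ⟨i, s, t, hst, -⟩ := h.hasDegree 0
    exact ⟨s, t, hst⟩
  let f : Fin (k + 1) → baseChordNotes (seventhChord c r) := fun a =>
    ⟨r + ((semitone a : ℝ) : PitchClass), (mem_baseChordNotes_iff hc).2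
      ((h.hasDegree a).imp fun _ => isDegree_add_iff.2)⟩
  have hf : Function.Bijective f := by
    refine ⟨fun a b hab => h.injective a b ?_, ?_⟩
    · exact pitchClass_eq_iff.1 (add_left_cancel (Subtype.ext_iff.1 hab))
    · rintro ⟨v, hv⟩
      obtain ⟨i, hi⟩ := (mem_baseChordNotes_iff hc).1 hv
      obtain ⟨s, t, hst, rfl⟩ := isDegree_iff.1 hi
      obtain ⟨a, ha⟩ := h.exists_eq s t hst i
      exact ⟨a, Subtype.ext (congr_arg (r + ·) (pitchClass_eq_iff.2 ha.symm))⟩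
  refine ⟨⟨Equiv.ofBijective f hf, fun {a b} => ?_⟩⟩
  rw [h.adj_iff a b]
  simp only [← isDegree_add_iff (r := r)]
  exact and_congr_left' hf.1.ne_iff

/-- A single line. -/
def line : TreeWithChords 6 0 where
  -- The first entry, for the root, is a filler here and below.
  parent := ![0, 0, 1, 2, 3, 4, 5]
  parent_lt := by decide
  chord := ![]
  chord_lt := by decide
  chord_ne := by decide
  chord_injective := by decide

/-- A line with a square in the middle. -/
def innerSquare : TreeWithChords 7 1 where
  parent := ![0, 0, 1, 2, 2, 3, 5, 6]
  parent_lt := by decide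
  chord := ![(4, 5)]
  chord_lt := by decide
  chord_ne := by decide
  chord_injective := by decide

/-- A line with a square at the end. -/
def finalSquare : TreeWithChords 7 1 where
  parent := ![0, 0, 1, 2, 3, 4, 4, 5]
  parent_lt := by decide
  chord := ![(6, 7)]
  chord_lt := by decide
  chord_ne := by decide
  chord_injective := by decide

/-- A chain of two squares, followed by a line. -/
def twoSquares : TreeWithChords 8 2 where
  parent := ![0, 0, 0, 1, 3, 3, 4, 6, 7]
  parent_lt := by decide
  chord := ![(2, 3), (5, 6)]
  chord_lt := by decide
  chord_ne := by decide
  chord_injective := by decide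

/-- A chain of three squares. -/
def threeSquares : TreeWithChords 9 3 where
  parent := ![0, 0, 0, 1, 3, 3, 4, 6, 6, 7]
  parent_lt := by decide
  chord := ![(2, 3), (5, 6), (8, 9)]
  chord_lt := by decide
  chord_ne := by decide
  chord_injective := by decide

/-- All parent scales and starting degrees are enumerated. In each list a square comes from a
tension degree with two values, such as 5 and 6 over `maj7sharp5`. -/
theorem models_dim7 : line.Models .dim7 ![0, 1, 3, 4, 6, 8, 9] := by
  constructor <;> decide +kernel

theorem models_maj7sharp5 : innerSquare.Models .maj7sharp5 ![0, 2, 4, 5, 6, 8, 9, 11] := by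
  constructor <;> decide +kernel

theorem models_minMaj7 : finalSquare.Models .minMaj7 ![0, 2, 3, 5, 7, 8, 9, 11] := by
  constructor <;> decide +kernel

theorem models_maj7 : twoSquares.Models .maj7 ![0, 2, 3, 4, 5, 6, 7, 9, 11] := by
  constructor <;> decide +kernel

theorem models_dom7 : threeSquares.Models .dom7 ![0, 1, 2, 4, 5, 6, 7, 8, 9, 10] := by
  constructor <;> decide +kernel

theorem models_min7 : threeSquares.Models .min7 ![0, 1, 2, 3, 5, 6, 7, 8, 9, 10] := by
  constructor <;> decide +kernel

theorem models_min7flat5 : threeSquares.Models .min7flat5 ![0, 1, 2, 3, 4, 5, 6, 8, 9, 10] := by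
  constructor <;> decide +kernel

/-- Here and below, a path from the root to the seventh occupies the positions 0 to 6. The remaining
corners of the squares follow in reverse order, so that their edges are nested and do not cross. -/
theorem nonempty_realization_line : Nonempty (GraphRealization line.graph 2) :=
  GraphRealization.nonempty_of_parabola _ ![0, 1, 2, 3, 4, 5, 6] (by decide) (by decide +kernel)

theorem nonempty_realization_innerSquare : Nonempty (GraphRealization innerSquare.graph 2) :=
  GraphRealization.nonempty_of_parabola _ ![0, 1, 2, 3, 7, 4, 5, 6] (by decide) (by decide +kernel)

theorem nonempty_realization_finalSquare : Nonempty (GraphRealization finalSquare.graph 2) :=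
  GraphRealization.nonempty_of_parabola _ ![0, 1, 2, 3, 4, 5, 7, 6] (by decide) (by decide +kernel)

theorem nonempty_realization_twoSquares : Nonempty (GraphRealization twoSquares.graph 2) :=
  GraphRealization.nonempty_of_parabola _ ![0, 1, 8, 2, 3, 7, 4, 5, 6] (by decide) (by decide +kernel)

theorem nonempty_realization_threeSquares : Nonempty (GraphRealization threeSquares.graph 2) :=
  GraphRealization.nonempty_of_parabola _ ![0, 1, 9, 2, 3, 8, 4, 5, 7, 6] (by decide) (by decide +kernel)

theorem Models.nonempty_realization {D : TreeWithChords k n} {c : ChordType}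
    {semitone : Fin (k + 1) → ℤ} (h : D.Models c semitone)
    (hD : Nonempty (GraphRealization D.graph 2)) (r : PitchClass) :
    Nonempty (GraphRealization (baseChordGraph (seventhChord c r)) 2) :=
  let ⟨φ⟩ := h.nonempty_iso r
  hD.map fun P => P.relabel φ.symm

theorem Models.fundamentalGroup {D : TreeWithChords k n} {c : ChordType}
    {semitone : Fin (k + 1) → ℤ} (h : D.Models c semitone) {r : PitchClass} {N : ℕ}
    (P : GraphRealization (baseChordGraph (seventhChord c r)) N) (x : P.carrier) :
    Nonempty (FundamentalGroup P.carrier x ≃* FreeGroup (Fin n)) ∧ P.complexity x = n :=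
  let ⟨φ⟩ := h.nonempty_iso r
  have hP := D.nonempty_fundamentalGroup_mulEquiv φ P x
  ⟨hP, GraphRealization.complexity_eq hP⟩

end TreeWithChords

end

theorem mainTheorem2 (r : PitchClass) :
    (∀ c : ChordType, Nonempty (GraphRealization (baseChordGraph (seventhChord c r)) 2)) ∧
    (∀ (N : ℕ) (P : GraphRealization (baseChordGraph (seventhChord .dim7 r)) N) (x : P.carrier),
      Subsingleton (FundamentalGroup P.carrier x) ∧ P.complexity x = 0) ∧
    (∀ (N : ℕ) (P : GraphRealization (baseChordGraph (seventhChord .maj7sharp5 r)) N)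
      (x : P.carrier),
      Nonempty (FundamentalGroup P.carrier x ≃* Multiplicative ℤ) ∧ P.complexity x = 1) ∧
    (∀ (N : ℕ) (P : GraphRealization (baseChordGraph (seventhChord .minMaj7 r)) N)
      (x : P.carrier),
      Nonempty (FundamentalGroup P.carrier x ≃* Multiplicative ℤ) ∧ P.complexity x = 1) ∧
    (∀ (N : ℕ) (P : GraphRealization (baseChordGraph (seventhChord .maj7 r)) N) (x : P.carrier),
      Nonempty (FundamentalGroup P.carrier x ≃* FreeGroup (Fin 2)) ∧ P.complexity x = 2) ∧
    (∀ (N : ℕ) (P : GraphRealization (baseChordGraph (seventhChord .dom7 r)) N) (x : P.carrier),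
      Nonempty (FundamentalGroup P.carrier x ≃* FreeGroup (Fin 3)) ∧ P.complexity x = 3) ∧
    (∀ (N : ℕ) (P : GraphRealization (baseChordGraph (seventhChord .min7 r)) N) (x : P.carrier),
      Nonempty (FundamentalGroup P.carrier x ≃* FreeGroup (Fin 3)) ∧ P.complexity x = 3) ∧
    (∀ (N : ℕ) (P : GraphRealization (baseChordGraph (seventhChord .min7flat5 r)) N)
      (x : P.carrier),
      Nonempty (FundamentalGroup P.carrier x ≃* FreeGroup (Fin 3)) ∧ P.complexity x = 3) := by
  open TreeWithChords in
  refine ⟨fun c => ?_, fun N P x => ?_, fun N P x => ?_, fun N P x => ?_,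
    fun N P x => models_maj7.fundamentalGroup P x, fun N P x => models_dom7.fundamentalGroup P x,
    fun N P x => models_min7.fundamentalGroup P x,
    fun N P x => models_min7flat5.fundamentalGroup P x⟩
  · cases c
    · exact models_dim7.nonempty_realization nonempty_realization_line r
    · exact models_maj7sharp5.nonempty_realization nonempty_realization_innerSquare r
    · exact models_minMaj7.nonempty_realization nonempty_realization_finalSquare r
    · exact models_maj7.nonempty_realization nonempty_realization_twoSquares r
    · exact models_dom7.nonempty_realization nonempty_realization_threeSquares r
    · exact models_min7.nonempty_realization nonempty_realization_threeSquares r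
    · exact models_min7flat5.nonempty_realization nonempty_realization_threeSquares r
  · obtain ⟨⟨e⟩, h⟩ := models_dim7.fundamentalGroup P x
    exact ⟨e.toEquiv.subsingleton, h⟩
  · obtain ⟨⟨e⟩, h⟩ := models_maj7sharp5.fundamentalGroup P x
    exact ⟨⟨e.trans FreeGroup.mulEquivIntOfUnique⟩, h⟩
  · obtain ⟨⟨e⟩, h⟩ := models_minMaj7.fundamentalGroup P x
    exact ⟨⟨e.trans FreeGroup.mulEquivIntOfUnique⟩, h⟩
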